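/- For $p\in[1,\infty)$, an $m\times n$ \emph{random binary matrix with sparsity $d\in\{1,\dots,m\}$} is the random matrix obtained by choosing, independently for each column, $d$ of its $m$ entries uniformly at random without replacement, setting these entries to $d^{-1/p}$ and all the other entries to $0$. A vector is \emph{$k$-sparse} if it has at most $k$ non-zero coordinates. \textbf{Theorem.} For every $\tau>0$ there is a constant $C_\tau>0$, depending only on $\tau$, such that the following holds. For every integer $n\ge 2$, every $k\in\{1,\dots,n\}$, every $\varepsilon\in(0,\tfrac12)$ and every real $p$ with $1+\tau\le p\le 2-\tau$, there exist positive integers $m$ and $d\le m$ with $$m\le C_\tau\left(k^p\,\frac{\log n}{\varepsilon^2}+k^{4-2/p-p}\,\frac{\log n}{\varepsilon^{2/(p-1)}}\right),\qquad d\le C_\tau\left(\frac{k^{p-1}\log n}{\varepsilon}+\frac{k^{(p-1)/p}\log n}{\varepsilon^{1/(p-1)}}\right)$$ such that, if $A$ is a random binary $m\times n$ matrix with sparsity $d$, then with probability at least $98\%$, $$(1-\varepsilon)\|x\|_p^p\le\|Ax\|_p^p\le(1+\varepsilon)\|x\|_p^p\qquad\text{for all $k$-sparse } x\in\mathbb{R}^n.$$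 Moreover, if $k\ge\varepsilon^{-p(2-p)/(p-1)^3}$, then these $m$ and $d$ satisfy the simpler bounds $$m\le C_\tau\,\frac{k^p\log n}{\varepsilon^2},\qquad d\le C_\tau\,\frac{k^{p-1}\log n}{\varepsilon}.$$ -/

import Mathlib

namespace RIP

/-- The norm `‖x‖_p = (∑ i, |x i| ^ p) ^ (1 / p)` on `ℝ^N`. -/
noncomputable def lpNorm {N : ℕ} (p : ℝ) (x : Fin N → ℝ) : ℝ :=
  ‖WithLp.toLp (ENNReal.ofReal p) x‖

/-- A vector is `k`-sparse if at most `k` of its coordinates are non-zero. -/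
def IsSparse {N : ℕ} (k : ℕ) (x : Fin N → ℝ) : Prop :=
  {j | x j ≠ 0}.ncard ≤ k

/-- The restricted isometry property of order `k` with distortion `ε` for the `ℓ_p` norm, in
`p`-th power form. -/
def IsRIPPow {m n : ℕ} (k : ℕ) (ε p : ℝ) (A : Matrix (Fin m) (Fin n) ℝ) : Prop :=
  ∀ x : Fin n → ℝ, IsSparse k x →
    (1 - ε) * lpNorm p x ^ p ≤ lpNorm p (A.mulVec x) ^ p ∧
      lpNorm p (A.mulVec x) ^ p ≤ (1 + ε) * lpNorm p x ^ p

/-- The matrix with value `d ^ (-1 / p)` in column `j` at the rows in `S j`, and `0` elsewhere. -/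
noncomputable def binaryMatrix {m n : ℕ} (p : ℝ) (d : ℕ) (S : Fin n → Finset (Fin m)) :
    Matrix (Fin m) (Fin n) ℝ :=
  Matrix.of fun i j => if i ∈ S j then (d : ℝ) ^ (-(1 / p)) else 0

/-- All ways of choosing, for each of the `n` columns, a set of exactly `d` of the `m` rows. -/
def columnSupports (m n d : ℕ) : Finset (Fin n → Finset (Fin m)) :=
  Fintype.piFinset fun _ => Finset.powersetCard d Finset.univ

theorem columnSupports_nonempty {m d : ℕ} (n : ℕ) (h : d ≤ m) :
    (columnSupports m n d).Nonempty := by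
  refine Fintype.piFinset_nonempty.2 fun _ => Finset.powersetCard_nonempty.2 ?_
  simpa using h

/-- The law of a random binary `m × n` matrix with sparsity `d ≤ m`: in each column, `d` entries
chosen uniformly at random without replacement, independently of the other columns (equivalently,
a uniformly random element of the product set `columnSupports m n d`), are set to `d ^ (-1 / p)`
and the other entries to `0`. -/
noncomputable def randomBinaryMatrix (p : ℝ) {m d : ℕ} (n : ℕ) (h : d ≤ m) :
    PMF (Matrix (Fin m) (Fin n) ℝ) :=
  (PMF.uniformOfFinset (columnSupports m n d) (columnSupports_nonempty n h)).map
    (binaryMatrix p d)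

end RIP

namespace RIP

open Finset

/-! If the column supports were disjoint, `‖Ax‖_p^p = ‖x‖_p^p` would hold exactly, so all distortion
comes from collisions in rows. The proof bounds collisions probabilistically, then the distortion
deterministically. Write `μ = d ^ 2 / m` and `L = log n`.

Probabilistic half: revealing the columns of `T` one at a time, each collision functional grows by a
sum over the new random support, so its exponential moment multiplies up column by column. Markov's
inequality gives failure probability `n ^ (-10 * #T)`, which survives a union bound over all
non-empty column sets (`card_not_fewCollisions_le`).

Deterministic half: in each row the largest entry dominates, and the error is at most `3 * t * y + 2
* y ^ p`, where `t` is the `(p - 1)`-th power of the largest modulus and `y` is the remaining mass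
(`abs_rpow_sum_sub_le`). Decomposing `|x|` and `|x| ^ (p - 1)` into nested superlevel sets turns `t`
and `y` into weighted sums of hit indicators and repeated-hit counts, which the collision bounds
control. The total relative error is `(26 * μ * k + 130 * L * k ^ (p - 1)) / d`
(`abs_sum_rows_sub_le`), and `exists_dimensions` makes it at most `ε`. -/

/-! ### Exponential moments for one random `d`-subset -/

theorem descFactorial_mul_pow_le {m d : ℕ} (h : d ≤ m) (v : ℕ) :
    d.descFactorial v * m ^ v ≤ m.descFactorial v * d ^ v := by
  induction v with
  | zero => simp
  | succ v ih =>
    have h1 : (d - v) * m ≤ (m - v) * d := by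
      rw [Nat.sub_mul, Nat.sub_mul, mul_comm m d]
      exact Nat.sub_le_sub_left (Nat.mul_le_mul_left v h) _
    calc d.descFactorial (v + 1) * m ^ (v + 1)
        = ((d - v) * m) * (d.descFactorial v * m ^ v) := by
          rw [Nat.descFactorial_succ]; ring
      _ ≤ ((m - v) * d) * (m.descFactorial v * d ^ v) := Nat.mul_le_mul h1 ih
      _ = _ := by rw [Nat.descFactorial_succ]; ring

/-- A uniform `d`-subset contains `V` with probability at most `(d / m) ^ #V`, because each factor
`(d - v) / (m - v)` is at most `d / m`. -/
theorem card_supersets_mul_pow_le {m d : ℕ} (h : d ≤ m) (V : Finset (Fin m)) :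
    #{U ∈ powersetCard d univ | V ⊆ U} * m ^ #V ≤ m.choose d * d ^ #V := by
  classical
  rcases lt_or_ge d (#V) with hV | hVd
  · rw [filter_false_of_mem fun U hU hVU => ?_]
    · simp
    · have := card_le_card hVU
      rw [(mem_powersetCard.1 hU).2] at this
      omega
  rw [card_filter_powersetCard_subset _ _ _ (subset_univ _) hVd]
  simp only [card_univ, Fintype.card_fin]
  refine Nat.le_of_mul_le_mul_left (c := m.descFactorial #V) ?_
    (Nat.descFactorial_pos.2 (hVd.trans h))
  have key := Nat.choose_mul (n := m) (k := d) (s := #V) hVd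
  have e : m.descFactorial #V * (m - #V).choose (d - #V) = m.choose d * d.descFactorial #V := by
    rw [Nat.descFactorial_eq_factorial_mul_choose, Nat.descFactorial_eq_factorial_mul_choose,
      mul_assoc, ← key]; ring
  calc _ = m.choose d * (d.descFactorial #V * m ^ #V) := by rw [← mul_assoc, e, mul_assoc]
    _ ≤ m.choose d * (m.descFactorial #V * d ^ #V) :=
      Nat.mul_le_mul_left _ (descFactorial_mul_pow_le h _)
    _ = _ := by ring

/-- Sampling without replacement is dominated by independent sampling. -/
theorem sum_powersetCard_prod_one_add_le {m d : ℕ} (hm : 0 < m) (hd : d ≤ m) (h : Fin m → ℝ)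
    (h0 : ∀ i, 0 ≤ h i) :
    ∑ U ∈ powersetCard d univ, ∏ i ∈ U, (1 + h i) ≤
      m.choose d * ∏ i, (1 + (d / m : ℝ) * h i) := by
  classical
  have hm' : (0 : ℝ) < m := by exact_mod_cast hm
  simp only [prod_one_add]
  -- Expand both products over subsets `V` and exchange sums; non-negativity of `h` allows a
  -- comparison term by term.
  have e : ∑ U ∈ powersetCard d (univ : Finset (Fin m)), ∑ V ∈ U.powerset, ∏ i ∈ V, h i =
      ∑ V ∈ (univ : Finset (Fin m)).powerset,
        (#{U ∈ powersetCard d univ | V ⊆ U} : ℝ) * ∏ i ∈ V, h i := by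
    simp only [card_filter, Nat.cast_sum, sum_mul]
    rw [sum_comm]
    refine sum_congr rfl fun U _ => ?_
    simp only [Nat.cast_ite, Nat.cast_one, Nat.cast_zero, ite_mul, one_mul, zero_mul]
    rw [← sum_filter]
    refine sum_congr ?_ fun _ _ => rfl
    ext V; simp
  rw [e, mul_sum]
  refine sum_le_sum fun V _ => ?_
  rw [prod_mul_distrib, prod_const, ← mul_assoc]
  refine mul_le_mul_of_nonneg_right ?_ (prod_nonneg fun i _ => h0 i)
  rw [div_pow, mul_div_assoc', le_div_iff₀ (by positivity)]
  exact_mod_cast card_supersets_mul_pow_le hd V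

theorem exp_le_one_add_two_mul {x : ℝ} (h0 : 0 ≤ x) (h1 : x ≤ 1) : Real.exp x ≤ 1 + 2 * x := by
  have h := Real.abs_exp_sub_one_le (x := x) (by rw [abs_of_nonneg h0]; exact h1)
  rw [abs_of_nonneg h0] at h
  linarith [le_abs_self (Real.exp x - 1)]

theorem sum_powersetCard_exp_le {m d : ℕ} (hm : 0 < m) (hd : d ≤ m) (g : Fin m → ℝ) {M : ℝ}
    (h0 : ∀ i, 0 ≤ g i) (h1 : ∀ i, g i ≤ 1) (hM : ∑ i, g i ≤ M) :
    ∑ U ∈ powersetCard d univ, Real.exp (∑ i ∈ U, g i) ≤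
      m.choose d * Real.exp (2 * (d / m) * M) := by
  calc ∑ U ∈ powersetCard d univ, Real.exp (∑ i ∈ U, g i)
      ≤ ∑ U ∈ powersetCard d univ, ∏ i ∈ U, (1 + 2 * g i) := by
        refine sum_le_sum fun U _ => ?_
        rw [Real.exp_sum]
        exact prod_le_prod (fun i _ => (Real.exp_pos _).le)
          fun i _ => exp_le_one_add_two_mul (h0 i) (h1 i)
    _ ≤ m.choose d * ∏ i, (1 + (d / m : ℝ) * (2 * g i)) :=
        sum_powersetCard_prod_one_add_le hm hd _ fun i => by linarith [h0 i]
    _ ≤ m.choose d * Real.exp (2 * (d / m) * M) := by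
        refine mul_le_mul_of_nonneg_left ?_ (by positivity)
        calc ∏ i, (1 + (d / m : ℝ) * (2 * g i)) ≤ ∏ i, Real.exp ((d / m : ℝ) * (2 * g i)) := by
              refine prod_le_prod (fun i _ => ?_) fun i _ => ?_
              · have := h0 i; positivity
              · rw [add_comm]; exact Real.add_one_le_exp _
          _ = Real.exp (2 * (d / m) * ∑ i, g i) := by
              rw [← Real.exp_sum, mul_sum]
              congr 1
              exact sum_congr rfl fun i _ => by ring
          _ ≤ _ := Real.exp_le_exp.2 (mul_le_mul_of_nonneg_left hM (by positivity))

/-! ### Revealing the columns one at a time -/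

theorem mem_columnSupports {m n d : ℕ} {S : Fin n → Finset (Fin m)} :
    S ∈ columnSupports m n d ↔ ∀ j, #(S j) = d := by
  simp [columnSupports, Fintype.mem_piFinset, mem_powersetCard]

/-- Resampling one column does not change an average over all column supports. -/
theorem sum_columnSupports_update {m n d : ℕ} (j : Fin n) (F : (Fin n → Finset (Fin m)) → ℝ) :
    ∑ S ∈ columnSupports m n d, ∑ U ∈ powersetCard d univ, F (Function.update S j U) =
      m.choose d * ∑ S ∈ columnSupports m n d, F S := by
  have e : ∑ S ∈ columnSupports m n d, ∑ _U ∈ powersetCard d (univ : Finset (Fin m)), F S =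
      m.choose d * ∑ S ∈ columnSupports m n d, F S := by
    simp [mul_sum, card_powersetCard]
  rw [← e, ← sum_product', ← sum_product']
  have hmem : ∀ a ∈ columnSupports m n d ×ˢ powersetCard d univ,
      (Function.update a.1 j a.2, a.1 j) ∈ columnSupports m n d ×ˢ powersetCard d univ := by
    rintro ⟨S, U⟩ h
    simp only [mem_product, mem_columnSupports, mem_powersetCard_univ] at h ⊢
    refine ⟨fun l => ?_, h.1 j⟩
    by_cases hl : l = j
    · subst hl; simpa using h.2
    · simpa [hl] using h.1 l
  -- Swapping column `j` with the fresh set is an involution of the pairs.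
  refine sum_nbij' (fun a => (Function.update a.1 j a.2, a.1 j))
    (fun a => (Function.update a.1 j a.2, a.1 j)) hmem hmem ?_ ?_ ?_ <;> simp

/-- One column's contribution to an exponential moment. -/
theorem sum_columnSupports_exp_step {m n d : ℕ} (hm : 0 < m) (hd : d ≤ m) (j : Fin n) {M : ℝ}
    (F : (Fin n → Finset (Fin m)) → ℝ) (g : (Fin n → Finset (Fin m)) → Fin m → ℝ)
    (hF : ∀ S U, F (Function.update S j U) = F S) (hg : ∀ S U, g (Function.update S j U) = g S)
    (hF0 : ∀ S, 0 ≤ F S) (g0 : ∀ S ∈ columnSupports m n d, ∀ i, 0 ≤ g S i)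
    (g1 : ∀ S ∈ columnSupports m n d, ∀ i, g S i ≤ 1)
    (gM : ∀ S ∈ columnSupports m n d, ∑ i, g S i ≤ M) :
    ∑ S ∈ columnSupports m n d, F S * Real.exp (∑ i ∈ S j, g S i) ≤
      Real.exp (2 * (d / m) * M) * ∑ S ∈ columnSupports m n d, F S := by
  have hc : (0 : ℝ) < m.choose d := by exact_mod_cast Nat.choose_pos hd
  refine le_of_mul_le_mul_left ?_ hc
  -- Resample column `j`: `F` and `g` do not see it, so the inner sum is the one-column estimate.
  rw [← sum_columnSupports_update j fun S => F S * Real.exp (∑ i ∈ S j, g S i)]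
  simp only [hF, hg, Function.update_self, ← mul_sum]
  calc _ ≤ ∑ S ∈ columnSupports m n d, F S * (m.choose d * Real.exp (2 * (d / m) * M)) :=
        sum_le_sum fun S hS => mul_le_mul_of_nonneg_left
          (sum_powersetCard_exp_le hm hd _ (g0 S hS) (g1 S hS) (gM S hS)) (hF0 S)
    _ = _ := by rw [← sum_mul]; ring

/-- Exponential moment of a functional built up column by column. -/
theorem sum_columnSupports_exp_le {m n d : ℕ} (hm : 0 < m) (hd : d ≤ m) {M : ℝ}
    (Φ : Finset (Fin n) → (Fin n → Finset (Fin m)) → ℝ)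
    (g : Finset (Fin n) → (Fin n → Finset (Fin m)) → Fin m → ℝ) (T : Finset (Fin n))
    (h0 : ∀ S, Φ ∅ S ≤ 0)
    (hΦ : ∀ T' ⊆ T, ∀ j ∈ T, j ∉ T' → ∀ S U, Φ T' (Function.update S j U) = Φ T' S)
    (hg : ∀ T' ⊆ T, ∀ j ∈ T, j ∉ T' → ∀ S U, g T' (Function.update S j U) = g T' S)
    (hstep : ∀ T' ⊆ T, ∀ j ∈ T, j ∉ T' → ∀ S ∈ columnSupports m n d,
      Φ (insert j T') S ≤ Φ T' S + ∑ i ∈ S j, g T' S i)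
    (g0 : ∀ T' ⊆ T, ∀ S ∈ columnSupports m n d, ∀ i, 0 ≤ g T' S i)
    (g1 : ∀ T' ⊂ T, ∀ S ∈ columnSupports m n d, ∀ i, g T' S i ≤ 1)
    (gM : ∀ T' ⊆ T, ∀ S ∈ columnSupports m n d, ∑ i, g T' S i ≤ M) :
    ∑ S ∈ columnSupports m n d, Real.exp (Φ T S) ≤
      Real.exp (2 * (d / m) * M * #T) * #(columnSupports m n d) := by
  suffices H : ∀ T' ⊆ T, ∑ S ∈ columnSupports m n d, Real.exp (Φ T' S) ≤
      Real.exp (2 * (d / m) * M * #T') * #(columnSupports m n d) from H T subset_rfl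
  intro T'
  induction T' using Finset.induction_on with
  | empty =>
    intro _
    simp only [card_empty, Nat.cast_zero, mul_zero, Real.exp_zero, one_mul]
    calc _ ≤ ∑ S ∈ columnSupports m n d, (1 : ℝ) :=
          sum_le_sum fun S _ => Real.exp_le_one_iff.2 (h0 S)
      _ = _ := by simp
  | insert j T' hj ih =>
    intro hT
    have hjT : j ∈ T := hT (mem_insert_self _ _)
    have hT' : T' ⊆ T := (subset_insert _ _).trans hT
    have hss : T' ⊂ T := ⟨hT', fun h => hj (h hjT)⟩
    calc ∑ S ∈ columnSupports m n d, Real.exp (Φ (insert j T') S)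
        ≤ ∑ S ∈ columnSupports m n d, Real.exp (Φ T' S) * Real.exp (∑ i ∈ S j, g T' S i) := by
          refine sum_le_sum fun S hS => ?_
          rw [← Real.exp_add]
          exact Real.exp_le_exp.2 (hstep T' hT' j hjT hj S hS)
      _ ≤ Real.exp (2 * (d / m) * M) * ∑ S ∈ columnSupports m n d, Real.exp (Φ T' S) :=
          sum_columnSupports_exp_step hm hd j _ _ (fun S U => by rw [hΦ T' hT' j hjT hj])
            (hg T' hT' j hjT hj) (fun S => (Real.exp_pos _).le) (g0 T' hT') (g1 T' hss)
            (gM T' hT')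
      _ ≤ Real.exp (2 * (d / m) * M) *
          (Real.exp (2 * (d / m) * M * #T') * #(columnSupports m n d)) :=
          mul_le_mul_of_nonneg_left (ih hT') (Real.exp_pos _).le
      _ = _ := by
          rw [← mul_assoc, ← Real.exp_add, card_insert_of_notMem hj]
          push_cast
          ring_nf

/-! ### Collision functionals and their exponential moments -/

/-- The number of columns in `T` whose support contains the row `i`. -/
def rowCount {m n : ℕ} (S : Fin n → Finset (Fin m)) (T : Finset (Fin n)) (i : Fin m) : ℕ :=
  #{j ∈ T | i ∈ S j}

/-- The `p`-th power sum, over the rows, of the number of repeated hits by the columns in `T`. -/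
noncomputable def excessPow {m n : ℕ} (p : ℝ) (S : Fin n → Finset (Fin m)) (T : Finset (Fin n)) :
    ℝ :=
  ∑ i, ((rowCount S T i - 1 : ℕ) : ℝ) ^ p

/-- The number of incidences of columns in `T` with rows that are hit by columns in `Q`. -/
def hits {m n : ℕ} (S : Fin n → Finset (Fin m)) (Q T : Finset (Fin n)) : ℕ :=
  ∑ j ∈ T, #{i ∈ S j | rowCount S Q i ≠ 0}

theorem rowCount_insert {m n : ℕ} (S : Fin n → Finset (Fin m)) {T : Finset (Fin n)} {j : Fin n}
    (hj : j ∉ T) (i : Fin m) :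
    rowCount S (insert j T) i = rowCount S T i + if i ∈ S j then 1 else 0 := by
  unfold rowCount
  rw [filter_insert]
  split_ifs with h
  · rw [card_insert_of_notMem (by simp [hj])]
  · simp

theorem rowCount_update {m n : ℕ} (S : Fin n → Finset (Fin m)) {T : Finset (Fin n)} {j : Fin n}
    (hj : j ∉ T) (U : Finset (Fin m)) : rowCount (Function.update S j U) T = rowCount S T := by
  funext i
  unfold rowCount
  congr 1
  refine filter_congr fun l hl => ?_
  rw [Function.update_of_ne (ne_of_mem_of_not_mem hl hj)]

theorem rowCount_le_card {m n : ℕ} (S : Fin n → Finset (Fin m)) (T : Finset (Fin n)) (i : Fin m) :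
    rowCount S T i ≤ #T := card_filter_le _ _

theorem rowCount_mono {m n : ℕ} (S : Fin n → Finset (Fin m)) {T T' : Finset (Fin n)}
    (h : T ⊆ T') (i : Fin m) : rowCount S T i ≤ rowCount S T' i :=
  card_le_card (filter_subset_filter _ h)

theorem sum_rowCount {m n d : ℕ} {S : Fin n → Finset (Fin m)} (hS : S ∈ columnSupports m n d)
    (T : Finset (Fin n)) : ∑ i, rowCount S T i = #T * d := by
  unfold rowCount
  simp only [card_filter]
  rw [sum_comm]
  simp [mem_columnSupports.1 hS]

/-- Convexity: the graph lies above its tangent at `a`. For `b > 0` this is Bernoulli's inequality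
at `b / a - 1`, scaled by `a ^ p`. -/
theorem rpow_sub_rpow_le {p a b : ℝ} (hp : 1 ≤ p) (hb : 0 ≤ b) (hab : b ≤ a) :
    a ^ p - b ^ p ≤ p * a ^ (p - 1) * (a - b) := by
  rcases hb.eq_or_lt with rfl | hb0
  · rcases hab.eq_or_lt with rfl | ha
    · simp
    · rw [Real.zero_rpow (by linarith)]
      have : a ^ p = a ^ (p - 1) * a := by
        rw [← Real.rpow_add_one ha.ne']; ring_nf
      rw [this, sub_zero, sub_zero, mul_assoc]
      have := Real.rpow_pos_of_pos ha (p - 1)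
      nlinarith [mul_pos this ha]
  · have ha : 0 < a := hb0.trans_le hab
    have h := one_add_mul_self_le_rpow_one_add (s := b / a - 1)
      (by have := div_pos hb0 ha; linarith) hp
    rw [add_sub_cancel, Real.div_rpow hb ha.le, le_div_iff₀ (Real.rpow_pos_of_pos ha p)] at h
    have e : a ^ p = a ^ (p - 1) * a := by
      rw [← Real.rpow_add_one ha.ne']; ring_nf
    have e2 : (1 + p * (b / a - 1)) * a ^ p = a ^ p - p * a ^ (p - 1) * (a - b) := by
      rw [e]; field_simp; ring
    linarith

theorem excess_increment_nonneg {p : ℝ} (hp : 1 ≤ p) (r : ℕ) :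
    0 ≤ (r : ℝ) ^ p - ((r - 1 : ℕ) : ℝ) ^ p :=
  sub_nonneg.2 (Real.rpow_le_rpow (by positivity) (by exact_mod_cast Nat.sub_le r 1)
    (by linarith))

theorem excess_increment_le {p : ℝ} (hp : 1 ≤ p) (hp2 : p ≤ 2) {r : ℕ} (hr : r ≠ 0) :
    (r : ℝ) ^ p - ((r - 1 : ℕ) : ℝ) ^ p ≤ 2 * (r : ℝ) ^ (p - 1) := by
  have h := rpow_sub_rpow_le (a := r) (b := ((r - 1 : ℕ) : ℝ)) hp (by positivity)
    (by exact_mod_cast Nat.sub_le r 1)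
  rw [Nat.cast_sub (Nat.one_le_iff_ne_zero.2 hr)] at h ⊢
  have h0 : (0 : ℝ) ≤ (r : ℝ) ^ (p - 1) := by positivity
  push_cast at h ⊢
  nlinarith

theorem excess_increment_le_mul {p : ℝ} (hp : 1 ≤ p) (hp2 : p ≤ 2) (r : ℕ) :
    (r : ℝ) ^ p - ((r - 1 : ℕ) : ℝ) ^ p ≤ 2 * r := by
  rcases eq_or_ne r 0 with rfl | hr
  · simp [Real.zero_rpow (show p ≠ 0 by linarith)]
  · refine (excess_increment_le hp hp2 hr).trans ?_
    have h1 : (1 : ℝ) ≤ r := by exact_mod_cast Nat.one_le_iff_ne_zero.2 hr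
    have := Real.rpow_le_rpow_of_exponent_le h1 (show p - 1 ≤ 1 by linarith)
    rw [Real.rpow_one] at this
    linarith

theorem excess_increment_le_pow {p : ℝ} (hp : 1 ≤ p) (hp2 : p ≤ 2) {r s : ℕ} (hrs : r ≤ s) :
    (r : ℝ) ^ p - ((r - 1 : ℕ) : ℝ) ^ p ≤ 2 * (s : ℝ) ^ (p - 1) := by
  rcases eq_or_ne r 0 with rfl | hr
  · have : (0 : ℝ) ≤ (s : ℝ) ^ (p - 1) := by positivity
    simpa [Real.zero_rpow (show p ≠ 0 by linarith)]
  · refine (excess_increment_le hp hp2 hr).trans ?_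
    have := Real.rpow_le_rpow (by positivity) (by exact_mod_cast hrs : (r : ℝ) ≤ s)
      (show 0 ≤ p - 1 by linarith)
    linarith

/-- Only rows of the new column change. Truncated subtraction makes the increment vanish at a first
hit. -/
theorem excessPow_insert {m n : ℕ} (p : ℝ) (S : Fin n → Finset (Fin m)) {T : Finset (Fin n)}
    {j : Fin n} (hj : j ∉ T) :
    excessPow p S (insert j T) = excessPow p S T +
      ∑ i ∈ S j, ((rowCount S T i : ℝ) ^ p - ((rowCount S T i - 1 : ℕ) : ℝ) ^ p) := by
  unfold excessPow
  rw [← sum_filter_add_sum_filter_not univ (fun i => i ∈ S j),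
    ← sum_filter_add_sum_filter_not univ (fun i => i ∈ S j)
      (fun i => ((rowCount S T i - 1 : ℕ) : ℝ) ^ p)]
  have e1 : (univ.filter fun i => i ∈ S j) = S j := by ext; simp
  have e2 : ∑ i ∈ univ.filter (fun i => ¬ i ∈ S j),
      ((rowCount S (insert j T) i - 1 : ℕ) : ℝ) ^ p =
      ∑ i ∈ univ.filter (fun i => ¬ i ∈ S j), ((rowCount S T i - 1 : ℕ) : ℝ) ^ p := by
    refine sum_congr rfl fun i hi => ?_
    rw [rowCount_insert S hj, if_neg (mem_filter.1 hi).2, add_zero]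
  have e3 : ∑ i ∈ S j, ((rowCount S (insert j T) i - 1 : ℕ) : ℝ) ^ p =
      ∑ i ∈ S j, (rowCount S T i : ℝ) ^ p := by
    refine sum_congr rfl fun i hi => ?_
    rw [rowCount_insert S hj, if_pos hi, Nat.add_sub_cancel]
  rw [e1, e2, e3, sum_sub_distrib]
  ring

theorem excessPow_empty {m n : ℕ} {p : ℝ} (hp : 1 ≤ p) (S : Fin n → Finset (Fin m)) :
    excessPow p S ∅ = 0 := by
  simp [excessPow, rowCount, Real.zero_rpow (show p ≠ 0 by linarith)]

theorem sum_exp_excessPow_le {m n d : ℕ} {p : ℝ} (hp : 1 ≤ p) (hp2 : p ≤ 2) (hm : 0 < m)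
    (hd : d ≤ m) {T : Finset (Fin n)} (hT : T.Nonempty) :
    ∑ S ∈ columnSupports m n d, Real.exp (excessPow p S T / (2 * (#T : ℝ) ^ (p - 1))) ≤
      Real.exp (4 * (#T : ℝ) ^ 2 * (d ^ 2 / m) / (2 * (#T : ℝ) ^ (p - 1))) *
        #(columnSupports m n d) := by
  have hs : (0 : ℝ) < #T := by exact_mod_cast hT.card_pos
  -- Row counts are at most `#T`, so dividing by `R` brings every increment below `1`. The
  -- increments are also at most `2 * r`, and the row counts sum to at most `#T * d`, which gives
  -- `M`.
  set R : ℝ := 2 * (#T : ℝ) ^ (p - 1) with hR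
  have hR0 : 0 < R := by positivity
  have h := sum_columnSupports_exp_le (d := d) hm hd (M := 2 * (#T * d) / R)
    (fun T' S => excessPow p S T' / R)
    (fun T' S i => ((rowCount S T' i : ℝ) ^ p - ((rowCount S T' i - 1 : ℕ) : ℝ) ^ p) / R) T
    (fun S => by simp [excessPow_empty hp])
    (fun T' _ j _ hj S U => by simp only [excessPow, rowCount_update S hj])
    (fun T' _ j _ hj S U => by simp only [rowCount_update S hj])
    (fun T' _ j _ hj S _ => by
      rw [excessPow_insert p S hj, add_div, sum_div])
    (fun T' _ S _ i => div_nonneg (excess_increment_nonneg hp _) hR0.le)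
    (fun T' hT' S _ i => (div_le_one hR0).2 (excess_increment_le_pow hp hp2
      ((rowCount_le_card S T' i).trans (card_le_card hT'.1))))
    (fun T' hT' S hS => by
      rw [← sum_div]
      refine div_le_div_of_nonneg_right ?_ hR0.le
      calc _ ≤ ∑ i, 2 * (rowCount S T' i : ℝ) :=
            sum_le_sum fun i _ => excess_increment_le_mul hp hp2 _
        _ = 2 * (#T' * d) := by rw [← mul_sum]; exact_mod_cast congrArg (2 * ·) (sum_rowCount hS T')
        _ ≤ _ := by
          have : (#T' : ℝ) ≤ #T := by exact_mod_cast card_le_card hT'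
          gcongr)
  refine h.trans (le_of_eq ?_)
  congr 2
  field_simp
  ring

/-- Disjointness keeps the rows hit by `Q` fixed while the columns of `T` are revealed; there are at
most `#Q * d` such rows. -/
theorem sum_exp_hits_le {m n d : ℕ} (hm : 0 < m) (hd : d ≤ m) {Q T : Finset (Fin n)}
    (hQT : Disjoint Q T) :
    ∑ S ∈ columnSupports m n d, Real.exp (hits S Q T) ≤
      Real.exp (2 * #T * #Q * (d ^ 2 / m)) * #(columnSupports m n d) := by
  have hjQ : ∀ j ∈ T, j ∉ Q := fun j hj hjQ => disjoint_left.1 hQT hjQ hj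
  have h := sum_columnSupports_exp_le (d := d) hm hd (M := #Q * d)
    (fun T' S => (hits S Q T' : ℝ)) (fun _ S i => if rowCount S Q i ≠ 0 then 1 else 0) T
    (fun S => by simp [hits])
    (fun T' _ j hjT hj S U => by
      simp only [hits, rowCount_update S (hjQ j hjT)]
      congr 1
      refine sum_congr rfl fun l hl => ?_
      rw [Function.update_of_ne (ne_of_mem_of_not_mem hl hj)])
    (fun T' _ j hjT hj S U => by simp only [rowCount_update S (hjQ j hjT)])
    (fun T' _ j hjT hj S _ => by
      simp only [hits, sum_insert hj, sum_boole]
      push_cast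
      linarith)
    (fun T' _ S _ i => by split_ifs <;> norm_num)
    (fun T' _ S _ i => by split_ifs <;> norm_num)
    (fun T' _ S hS => by
      have h1 := sum_rowCount hS Q
      calc _ ≤ ∑ i, (rowCount S Q i : ℝ) := by
            refine sum_le_sum fun i _ => ?_
            split_ifs with h
            · exact_mod_cast Nat.one_le_iff_ne_zero.2 h
            · positivity
        _ = _ := by exact_mod_cast h1)
  refine h.trans (le_of_eq ?_)
  congr 2
  ring

/-! ### Tail bounds and the union bound -/

theorem card_filter_lt_mul_exp_le {α : Type*} (s : Finset α) (f : α → ℝ) (a b : ℝ)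
    (h : ∑ x ∈ s, Real.exp (f x) ≤ Real.exp b * #s) :
    (#{x ∈ s | a + b < f x} : ℝ) ≤ Real.exp (-a) * #s := by
  have h1 : (#{x ∈ s | a + b < f x} : ℝ) * Real.exp (a + b) ≤ ∑ x ∈ s, Real.exp (f x) := by
    rw [← nsmul_eq_mul]
    calc _ ≤ ∑ x ∈ s with a + b < f x, Real.exp (f x) :=
          card_nsmul_le_sum _ _ _ fun x hx => Real.exp_le_exp.2 (mem_filter.1 hx).2.le
      _ ≤ _ := sum_le_sum_of_subset_of_nonneg (filter_subset _ _)
          fun _ _ _ => (Real.exp_pos _).le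
  have h2 := h1.trans h
  rw [← le_div_iff₀ (Real.exp_pos _)] at h2
  refine h2.trans (le_of_eq ?_)
  rw [mul_div_right_comm, ← Real.exp_sub]
  ring_nf

/-- Regularity of the collision pattern of the columns, with collision rate `μ` and
logarithmic term `L`. -/
structure FewCollisions {m n : ℕ} (p μ L : ℝ) (S : Fin n → Finset (Fin m)) : Prop where
  pow_le : ∀ T, excessPow p S T ≤ 20 * #T ^ p * L + 4 * #T ^ 2 * μ
  one_le : ∀ T, excessPow 1 S T ≤ 20 * #T * L + 4 * #T ^ 2 * μ
  hits_le : ∀ Q T, Disjoint Q T → hits S Q T ≤ 10 * (#Q + #T) * L + 2 * #T * #Q * μ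

theorem card_excessPow_gt_le {m n d : ℕ} {p L : ℝ} (hp : 1 ≤ p) (hp2 : p ≤ 2) (hm : 0 < m)
    (hd : d ≤ m) {T : Finset (Fin n)} (hT : T.Nonempty) :
    (#{S ∈ columnSupports m n d |
        20 * (#T : ℝ) ^ p * L + 4 * #T ^ 2 * (d ^ 2 / m) < excessPow p S T} : ℝ) ≤
      Real.exp (-(10 * L)) ^ #T * #(columnSupports m n d) := by
  have hs : (0 : ℝ) < #T := by exact_mod_cast hT.card_pos
  have h := card_filter_lt_mul_exp_le _ _ (10 * L * #T) _ (sum_exp_excessPow_le hp hp2 hm hd hT)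
  rw [← Real.exp_nat_mul, show (#T : ℝ) * -(10 * L) = -(10 * L * #T) by ring]
  refine le_trans (le_of_eq ?_) h
  congr 2
  refine filter_congr fun S _ => ?_
  have hR0 : 0 < 2 * (#T : ℝ) ^ (p - 1) := by positivity
  rw [lt_div_iff₀ hR0, add_mul, div_mul_cancel₀ _ hR0.ne']
  have e : (#T : ℝ) ^ p = #T ^ (p - 1) * #T := by
    rw [← Real.rpow_add_one hs.ne']; ring_nf
  rw [e]
  ring_nf

theorem card_hits_gt_le {m n d : ℕ} {L : ℝ} (hm : 0 < m) (hd : d ≤ m) {Q T : Finset (Fin n)}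
    (hQT : Disjoint Q T) :
    (#{S ∈ columnSupports m n d |
        10 * (#Q + #T : ℝ) * L + 2 * #T * #Q * (d ^ 2 / m) < hits S Q T} : ℝ) ≤
      Real.exp (-(10 * L)) ^ #Q * Real.exp (-(10 * L)) ^ #T * #(columnSupports m n d) := by
  have h := card_filter_lt_mul_exp_le _ _ (10 * (#Q + #T : ℝ) * L) _ (sum_exp_hits_le hm hd hQT)
  refine h.trans (le_of_eq ?_)
  rw [← pow_add, ← Real.exp_nat_mul]
  push_cast
  ring_nf

theorem sum_pow_card_finset (n : ℕ) (q : ℝ) : ∑ T : Finset (Fin n), q ^ #T = (1 + q) ^ n := by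
  have h := prod_one_add (f := fun _ : Fin n => q) univ
  simpa using h.symm

open Classical in
theorem card_not_fewCollisions_le {m n d : ℕ} {p : ℝ} (hp : 1 ≤ p) (hp2 : p ≤ 2) (hm : 0 < m)
    (hd : d ≤ m) (hn : 2 ≤ n) :
    (#{S ∈ columnSupports m n d | ¬ FewCollisions p (d ^ 2 / m) (Real.log n) S} : ℝ) ≤
      1 / 50 * #(columnSupports m n d) := by
  set Ω := columnSupports m n d
  set L := Real.log n
  set μ : ℝ := d ^ 2 / m
  set q : ℝ := Real.exp (-(10 * L)) with hq
  let B : ℝ → Finset (Fin n) → Finset (Fin n → Finset (Fin m)) := fun p T =>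
    {S ∈ Ω | 20 * (#T : ℝ) ^ p * L + 4 * #T ^ 2 * μ < excessPow p S T}
  let H : Finset (Fin n) × Finset (Fin n) → Finset (Fin n → Finset (Fin m)) := fun a =>
    {S ∈ Ω | 10 * (#a.1 + #a.2 : ℝ) * L + 2 * #a.2 * #a.1 * μ < hits S a.1 a.2}
  -- Empty sets must be left out, since their tail bound is only `q ^ 0 = 1`; their inequalities
  -- hold trivially.
  let I : Finset (Finset (Fin n) × Finset (Fin n)) :=
    (univ.filter fun a => Disjoint a.1 a.2).erase (∅, ∅)
  have hq0 : 0 ≤ q := (Real.exp_pos _).le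
  have hsub : {S ∈ Ω | ¬ FewCollisions p μ L S} ⊆
      ((univ.erase ∅).biUnion (B p) ∪ (univ.erase ∅).biUnion (B 1)) ∪ I.biUnion H := by
    intro S hS
    obtain ⟨hSΩ, hbad⟩ := mem_filter.1 hS
    by_contra hcon
    simp only [mem_union, mem_biUnion, mem_erase, mem_univ, and_true, not_or, not_exists,
      not_and, B, H, I, mem_filter, not_lt, true_and, hSΩ] at hcon
    obtain ⟨⟨h1, h2⟩, h3⟩ := hcon
    refine hbad ⟨fun T => ?_, fun T => ?_, fun Q T hQT => ?_⟩
    · rcases T.eq_empty_or_nonempty with rfl | hT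
      · simp [excessPow_empty hp, Real.zero_rpow (show p ≠ 0 by linarith)]
      · exact h1 T hT.ne_empty
    · rcases T.eq_empty_or_nonempty with rfl | hT
      · simp [excessPow_empty le_rfl]
      · simpa using h2 T hT.ne_empty
    · by_cases h0 : (Q, T) = (∅, ∅)
      · simp only [Prod.mk.injEq] at h0
        simp [h0.1, h0.2, hits]
      · exact h3 (Q, T) ⟨h0, hQT⟩
  have hB : ∀ p', 1 ≤ p' → p' ≤ 2 →
      (#((univ.erase ∅).biUnion (B p')) : ℝ) ≤ ((1 + q) ^ n - 1) * #Ω := by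
    intro p' h1 h2
    calc (#((univ.erase ∅).biUnion (B p')) : ℝ)
        ≤ ∑ T ∈ univ.erase ∅, (#(B p' T) : ℝ) := by exact_mod_cast card_biUnion_le
      _ ≤ ∑ T ∈ univ.erase (∅ : Finset (Fin n)), q ^ #T * #Ω := sum_le_sum fun T hT =>
          card_excessPow_gt_le h1 h2 hm hd (nonempty_iff_ne_empty.2 (mem_erase.1 hT).1)
      _ = _ := by
          rw [← sum_mul, ← sum_pow_card_finset, ← add_sum_erase univ _ (mem_univ ∅)]
          simp
  have hH : (#(I.biUnion H) : ℝ) ≤ ((1 + q) ^ n * (1 + q) ^ n - 1) * #Ω := by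
    calc (#(I.biUnion H) : ℝ) ≤ ∑ a ∈ I, (#(H a) : ℝ) := by exact_mod_cast card_biUnion_le
      _ ≤ ∑ a ∈ I, q ^ #a.1 * q ^ #a.2 * #Ω := sum_le_sum fun a ha =>
          card_hits_gt_le hm hd (mem_filter.1 (mem_of_mem_erase ha)).2
      _ ≤ ∑ a ∈ univ.erase (∅, ∅), q ^ #a.1 * q ^ #a.2 * #Ω := by
          refine sum_le_sum_of_subset_of_nonneg (erase_subset_erase _ (filter_subset _ _)) ?_
          intros; positivity
      _ = _ := by
          have h1 : ∑ a : Finset (Fin n) × Finset (Fin n), q ^ #a.1 * q ^ #a.2 =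
              (1 + q) ^ n * (1 + q) ^ n := by
            rw [Fintype.sum_prod_type, ← sum_pow_card_finset, sum_mul_sum]
          rw [← sum_mul, ← h1, ← add_sum_erase univ _ (mem_univ (∅, ∅))]
          simp
  -- Here `q = n ^ (-10)`, so `n * q = n ^ (-9) ≤ 2 ^ (-9)`. The three union bounds then total about
  -- `8 * n * q ≤ 1 / 64`, below `1 / 50`.
  have hnq : n * q ≤ 1 / 512 := by
    have hn0 : (0 : ℝ) < n := by positivity
    have h2 : (2 : ℝ) ≤ n := by exact_mod_cast hn
    have : q = ((n : ℝ) ^ 10)⁻¹ := by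
      rw [hq, Real.exp_neg, mul_comm, Real.exp_mul, Real.exp_log hn0]
      norm_cast
    rw [this, show (n : ℝ) * ((n : ℝ) ^ 10)⁻¹ = ((n : ℝ) ^ 9)⁻¹ by field_simp, one_div]
    refine inv_anti₀ (by norm_num) ?_
    calc (512 : ℝ) = 2 ^ 9 := by norm_num
      _ ≤ _ := by gcongr
  have hpow : (1 + q) ^ n ≤ 1 + 2 * (n * q) := by
    calc (1 + q) ^ n ≤ Real.exp q ^ n := by
          gcongr; rw [add_comm]; exact Real.add_one_le_exp q
      _ = Real.exp (n * q) := by rw [← Real.exp_nat_mul]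
      _ ≤ _ := exp_le_one_add_two_mul (by positivity) (by linarith)
  have hpow1 : 1 ≤ (1 + q) ^ n := one_le_pow₀ (by linarith)
  have hcard : (#{S ∈ Ω | ¬ FewCollisions p μ L S} : ℝ) ≤
      #((univ.erase ∅).biUnion (B p)) + #((univ.erase ∅).biUnion (B 1)) + #(I.biUnion H) := by
    exact_mod_cast (card_le_card hsub).trans ((card_union_le _ _).trans
      (Nat.add_le_add_right (card_union_le _ _) _))
  have hfinal : ((1 + q) ^ n - 1) + ((1 + q) ^ n - 1) + ((1 + q) ^ n * (1 + q) ^ n - 1) ≤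
      1 / 50 := by nlinarith
  calc _ ≤ _ := hcard
    _ ≤ (((1 + q) ^ n - 1) + ((1 + q) ^ n - 1) + ((1 + q) ^ n * (1 + q) ^ n - 1)) * #Ω := by
        have := hB p hp hp2
        have := hB 1 le_rfl one_le_two
        linarith
    _ ≤ _ := mul_le_mul_of_nonneg_right hfinal (by positivity)

/-! ### Layer decompositions -/

/-- `x` is the superposition, with non-negative weights `c`, of the indicators of non-empty
sets that are upward closed for the order induced by `a`. -/
structure IsLayering {n : ℕ} (a x : Fin n → ℝ) (c : Finset (Fin n) → ℝ) : Prop where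
  nonneg : ∀ P, 0 ≤ c P
  nonempty : ∀ P, c P ≠ 0 → P.Nonempty
  upper : ∀ P, c P ≠ 0 → ∀ j ∈ P, ∀ l, a j ≤ a l → l ∈ P
  sum_eq : ∀ j, x j = ∑ P, if j ∈ P then c P else 0

theorem exists_isLayering {n : ℕ} (x : Fin n → ℝ) (h0 : ∀ j, 0 ≤ x j) :
    ∃ c, IsLayering x x c := by
  classical
  induction hN : #{j | x j ≠ 0} using Nat.strong_induction_on generalizing x with
  | _ N ih =>
    -- Peel off the support with weight the least non-zero value. This kills at least one coordinate
    -- and preserves the order, so later layers stay upward closed for `x`.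
    set P : Finset (Fin n) := {j | x j ≠ 0} with hP
    rcases P.eq_empty_or_nonempty with hE | hne
    · refine ⟨0, fun _ => le_rfl, fun P h => absurd rfl h, fun P h => absurd rfl h, fun j => ?_⟩
      have : j ∉ P := by rw [hE]; exact notMem_empty j
      simpa [hP] using this
    · obtain ⟨j₀, hj₀, hmin⟩ := exists_min_image P x hne
      have hpos : ∀ j, j ∈ P ↔ 0 < x j := fun j => by
        rw [hP, mem_filter]
        exact ⟨fun h => lt_of_le_of_ne (h0 j) (Ne.symm h.2), fun h => ⟨mem_univ _, h.ne'⟩⟩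
      let x' : Fin n → ℝ := fun j => x j - if j ∈ P then x j₀ else 0
      have hx'0 : ∀ j, 0 ≤ x' j := fun j => by
        simp only [x']
        split_ifs with h
        · exact sub_nonneg.2 (hmin j h)
        · simpa using h0 j
      have hx'P : ∀ j, j ∉ P → x' j = 0 := fun j hj => by
        have : x j = 0 := le_antisymm (not_lt.1 fun h => hj ((hpos j).2 h)) (h0 j)
        simp [x', hj, this]
      have hcard : #{j | x' j ≠ 0} < N := by
        rw [← hN]
        refine card_lt_card ⟨fun j hj => ?_, fun h => ?_⟩
        · by_contra hjP
          exact (mem_filter.1 hj).2 (hx'P j hjP)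
        · have := (mem_filter.1 (h hj₀)).2
          simp [x', hj₀] at this
      obtain ⟨c, hc⟩ := ih _ hcard x' hx'0 rfl
      have hmono : ∀ j l, x j ≤ x l → x' j ≤ x' l := fun j l hjl => by
        by_cases hj : j ∈ P
        · have hl : l ∈ P := (hpos l).2 (((hpos j).1 hj).trans_le hjl)
          simpa [x', hj, hl] using hjl
        · rw [hx'P j hj]; exact hx'0 l
      have hj₀pos := (hpos j₀).1 hj₀
      refine ⟨fun P' => c P' + if P' = P then x j₀ else 0, fun P' => ?_, fun P' h => ?_,
        fun P' h => ?_, fun j => ?_⟩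
      · have := hc.nonneg P'
        split_ifs <;> linarith
      · by_cases hPP : P' = P
        · rw [hPP]; exact hne
        · exact hc.nonempty P' (by simpa [hPP] using h)
      · by_cases hPP : P' = P
        · rw [hPP]
          exact fun j hj l hjl => (hpos l).2 (((hpos j).1 hj).trans_le hjl)
        · exact fun j hj l hjl =>
            hc.upper P' (by simpa [hPP] using h) j hj l (hmono j l hjl)
      · have h1 := hc.sum_eq j
        have h2 : ∀ P' : Finset (Fin n),
            (if j ∈ P' then c P' + (if P' = P then x j₀ else 0) else 0) =
            (if j ∈ P' then c P' else 0) +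
              if P' = P then (if j ∈ P then x j₀ else 0) else 0 := fun P' => by
          by_cases h : P' = P
          · subst h; split_ifs <;> simp
          · simp [h]
        rw [sum_congr rfl fun P' _ => h2 P', sum_add_distrib, ← h1, sum_ite_eq' univ P]
        simp [x']

namespace IsLayering

variable {n : ℕ} {a x : Fin n → ℝ} {c : Finset (Fin n) → ℝ}

theorem of_monotone (h : IsLayering x x c) (hm : ∀ j l, a j ≤ a l → x j ≤ x l) :
    IsLayering a x c where
  nonneg := h.nonneg
  nonempty := h.nonempty
  upper P hP j hj l hjl := h.upper P hP j hj l (hm j l hjl)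
  sum_eq := h.sum_eq

theorem sum_mul_card (h : IsLayering a x c) : ∑ P, c P * #P = ∑ j, x j := by
  simp only [h.sum_eq]
  rw [sum_comm]
  refine sum_congr rfl fun P _ => ?_
  rw [← sum_filter, sum_const, nsmul_eq_mul, mul_comm, filter_mem_eq_inter, univ_inter]

theorem pos_of_mem (h : IsLayering a x c) {P : Finset (Fin n)} (hP : c P ≠ 0) {j : Fin n}
    (hj : j ∈ P) : 0 < x j := by
  classical
  rw [h.sum_eq]
  refine sum_pos' (fun Q _ => ?_) ⟨P, mem_univ _, ?_⟩
  · split_ifs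
    exacts [h.nonneg Q, le_rfl]
  · rw [if_pos hj]
    exact lt_of_le_of_ne (h.nonneg P) (Ne.symm hP)

/-- Sets upward closed for one total preorder form a chain. This is why `|x|` and `|x| ^ (p - 1)`
are layered along the same `a`. -/
theorem subset_or_subset {y : Fin n → ℝ} {c' : Finset (Fin n) → ℝ} (h : IsLayering a x c)
    (h' : IsLayering a y c') {P Q : Finset (Fin n)} (hP : c P ≠ 0) (hQ : c' Q ≠ 0) :
    Q ⊆ P ∨ P ⊆ Q := by
  by_contra! hcon
  obtain ⟨⟨j, hj, hjP⟩, ⟨l, hl, hlQ⟩⟩ := And.imp not_subset.1 not_subset.1 hcon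
  rcases le_total (a j) (a l) with hjl | hjl
  · exact hlQ (h'.upper Q hQ j hj l hjl)
  · exact hjP (h.upper P hP l hl j hjl)

/-- At a maximizer `j` of `a` within a row, `x j` is the total weight of the layers meeting
the row. -/
theorem eq_sum_of_max {m : ℕ} (h : IsLayering a x c) (S : Fin n → Finset (Fin m)) {i : Fin m}
    {j : Fin n} (hj : i ∈ S j) (hmax : ∀ l, i ∈ S l → a l ≤ a j) :
    x j = ∑ P, if rowCount S P i ≠ 0 then c P else 0 := by
  rw [h.sum_eq]
  refine sum_congr rfl fun P _ => ?_
  by_cases hP : c P = 0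
  · simp [hP]
  refine if_congr ⟨fun hjP => ?_, fun hr => ?_⟩ rfl rfl
  · exact card_ne_zero_of_mem (mem_filter.2 ⟨hjP, hj⟩)
  · obtain ⟨l, hl⟩ := card_ne_zero.1 hr
    rw [mem_filter] at hl
    exact h.upper P hP l hl.1 j (hmax l hl.2)

/-- Every layer contains a maximizer of `a`, so the total weight is the value of `x` there. -/
theorem sum_le (h : IsLayering a x c) {B : ℝ} (hB0 : 0 ≤ B) (hB : ∀ j, x j ≤ B) :
    ∑ P, c P ≤ B := by
  by_cases hn : Nonempty (Fin n)
  · obtain ⟨j, -, hj⟩ := exists_max_image univ a univ_nonempty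
    refine le_trans (le_of_eq ?_) (hB j)
    rw [h.sum_eq]
    refine sum_congr rfl fun P _ => ?_
    by_cases hP : c P = 0
    · simp [hP]
    · obtain ⟨l, hl⟩ := h.nonempty P hP
      rw [if_pos (h.upper P hP l hl j (hj l (mem_univ _)))]
  · refine le_trans (le_of_eq (sum_eq_zero fun P _ => ?_)) hB0
    by_contra hP
    obtain ⟨l, -⟩ := h.nonempty P hP
    exact hn ⟨l⟩

theorem sum_row {m : ℕ} (h : IsLayering a x c) (S : Fin n → Finset (Fin m)) (i : Fin m) :
    ∑ j with i ∈ S j, x j = ∑ P, c P * rowCount S P i := by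
  simp only [h.sum_eq]
  rw [sum_comm]
  refine sum_congr rfl fun P _ => ?_
  rw [← sum_filter, sum_const, nsmul_eq_mul, mul_comm, filter_filter, rowCount]
  congr 3
  ext j; simp [and_comm]

/-- The mass of a row apart from its largest entry. -/
theorem sum_row_sub_max {m : ℕ} (h : IsLayering a x c) (S : Fin n → Finset (Fin m)) {i : Fin m}
    {j : Fin n} (hj : i ∈ S j) (hmax : ∀ l, i ∈ S l → a l ≤ a j) :
    ∑ l with i ∈ S l, x l - x j = ∑ P, c P * (rowCount S P i - 1 : ℕ) := by
  rw [h.sum_row, h.eq_sum_of_max S hj hmax, ← sum_sub_distrib]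
  refine sum_congr rfl fun P _ => ?_
  rcases Nat.eq_zero_or_pos (rowCount S P i) with h0 | h0
  · simp [h0]
  · rw [if_pos h0.ne', Nat.cast_sub h0]
    push_cast
    ring

end IsLayering

/-! ### The error in a single row -/

theorem rpow_sub_one_mul_self {p a : ℝ} (hp : 1 < p) (ha : 0 ≤ a) : a ^ (p - 1) * a = a ^ p := by
  rcases ha.eq_or_lt with rfl | ha
  · rw [mul_zero, Real.zero_rpow (by linarith)]
  · rw [← Real.rpow_add_one ha.ne']; ring_nf

theorem add_rpow_le {p a y : ℝ} (hp : 1 < p) (hp2 : p ≤ 2) (ha : 0 ≤ a) (hy : 0 ≤ y) :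
    (a + y) ^ p ≤ a ^ p + 2 * a ^ (p - 1) * y + 2 * y ^ p := by
  have h1 := rpow_sub_rpow_le hp.le ha (le_add_of_nonneg_right hy)
  have h2 := Real.rpow_add_le_add_rpow ha hy (show 0 ≤ p - 1 by linarith) (by linarith)
  have h3 := rpow_sub_one_mul_self hp hy
  have h4 : 0 ≤ (a + y) ^ (p - 1) * y := by positivity
  have h5 : p * ((a + y) ^ (p - 1) * y) ≤ 2 * ((a + y) ^ (p - 1) * y) :=
    mul_le_mul_of_nonneg_right hp2 h4
  have h6 := mul_le_mul_of_nonneg_right h2 hy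
  rw [add_sub_cancel_left, mul_assoc] at h1
  linarith

theorem rpow_le_of_sub_le {p a y w : ℝ} (hp : 1 < p) (hp2 : p ≤ 2) (ha : 0 ≤ a) (hw : 0 ≤ w)
    (hy : 0 ≤ y) (h : a - y ≤ w) : a ^ p ≤ w ^ p + 2 * a ^ (p - 1) * y := by
  have h0 : 0 ≤ a ^ (p - 1) := by positivity
  rcases le_total a w with haw | haw
  · have := Real.rpow_le_rpow ha haw (show 0 ≤ p by linarith)
    have : 0 ≤ 2 * a ^ (p - 1) * y := by positivity
    linarith
  · have h1 := rpow_sub_rpow_le hp.le hw haw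
    have : p * a ^ (p - 1) * (a - w) ≤ 2 * a ^ (p - 1) * y := by
      refine mul_le_mul (mul_le_mul_of_nonneg_right hp2 h0) (by linarith) (by linarith)
        (by positivity)
    linarith

/-- If one term of a sum dominates, then the `p`-th power of the sum is close to the sum of the
`p`-th powers. -/
theorem abs_rpow_sum_sub_le {ι : Type*} {p : ℝ} (hp : 1 < p) (hp2 : p ≤ 2) (R : Finset ι)
    (x : ι → ℝ) {j : ι} (hj : j ∈ R) (hmax : ∀ l ∈ R, |x l| ≤ |x j|) :
    |(|∑ l ∈ R, x l| ^ p - ∑ l ∈ R, |x l| ^ p)| ≤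
      3 * (|x j| ^ (p - 1) * (∑ l ∈ R, |x l| - |x j|)) + 2 * (∑ l ∈ R, |x l| - |x j|) ^ p := by
  classical
  have hy : ∑ l ∈ R, |x l| - |x j| = ∑ l ∈ R.erase j, |x l| := by
    rw [← add_sum_erase R _ hj, add_sub_cancel_left]
  rw [hy]
  set y := ∑ l ∈ R.erase j, |x l|
  have hy0 : 0 ≤ y := sum_nonneg fun _ _ => abs_nonneg _
  have hv : |(∑ l ∈ R, x l) - x j| ≤ y := by
    rw [← add_sum_erase R _ hj, add_sub_cancel_left]
    exact abs_sum_le_sum_abs _ _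
  have hup : |∑ l ∈ R, x l| ≤ |x j| + y := by
    have := abs_add_le (x j) ((∑ l ∈ R, x l) - x j)
    rw [add_sub_cancel] at this
    linarith
  have hlow : |x j| - y ≤ |∑ l ∈ R, x l| := by
    have := abs_sub_abs_le_abs_sub (x j) (∑ l ∈ R, x l)
    rw [abs_sub_comm] at this
    linarith
  have hX1 : |x j| ^ p ≤ ∑ l ∈ R, |x l| ^ p :=
    single_le_sum (f := fun l => |x l| ^ p) (fun l _ => by positivity) hj
  have hX2 : ∑ l ∈ R, |x l| ^ p ≤ |x j| ^ p + |x j| ^ (p - 1) * y := by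
    rw [← add_sum_erase R _ hj, mul_sum]
    gcongr with l hl
    rw [← rpow_sub_one_mul_self hp (abs_nonneg _)]
    exact mul_le_mul_of_nonneg_right (Real.rpow_le_rpow (abs_nonneg _)
      (hmax l (mem_of_mem_erase hl)) (by linarith)) (abs_nonneg _)
  have h1 := Real.rpow_le_rpow (abs_nonneg _) hup (show 0 ≤ p by linarith)
  have h2 := add_rpow_le hp hp2 (abs_nonneg (x j)) hy0
  have h3 := rpow_le_of_sub_le hp hp2 (abs_nonneg (x j)) (abs_nonneg _) hy0 hlow
  have h4 : 0 ≤ |x j| ^ (p - 1) * y := by positivity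
  have h5 : 0 ≤ y ^ p := by positivity
  rw [abs_le]
  constructor <;> linarith

/-! ### Deterministic distortion bound -/

theorem rowCount_sdiff {m n : ℕ} (S : Fin n → Finset (Fin m)) {Q P : Finset (Fin n)}
    (h : Q ⊆ P) (i : Fin m) : rowCount S P i = rowCount S Q i + rowCount S (P \ Q) i := by
  unfold rowCount
  rw [← card_union_of_disjoint, ← filter_union, union_sdiff_of_subset h]
  exact disjoint_filter_filter disjoint_sdiff

theorem hits_eq_sum {m n : ℕ} (S : Fin n → Finset (Fin m)) (Q T : Finset (Fin n)) :
    hits S Q T = ∑ i, if rowCount S Q i ≠ 0 then rowCount S T i else 0 := by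
  have e : ∀ j ∈ T, #{i ∈ S j | rowCount S Q i ≠ 0} =
      ∑ i, if rowCount S Q i ≠ 0 then (if i ∈ S j then 1 else 0) else 0 := fun j _ => by
    rw [← sum_filter, sum_boole, Nat.cast_id]
    congr 1
    ext i
    simp [and_comm]
  rw [hits, sum_congr rfl e, sum_comm]
  refine sum_congr rfl fun i _ => ?_
  split_ifs
  · rw [rowCount, card_filter]
  · simp

/-- If `Q ⊆ P`, the repeated hits of `P` in a row met by `Q` are those of `Q` plus the hits of `P \
Q`. If `P ⊆ Q`, the excess of `P` alone suffices. The `L` term carries no factor `#Q`, so after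
weighting it involves only the total weight of the layers `Q`. -/
theorem excess_on_rows_le {m n : ℕ} {p μ L : ℝ} {S : Fin n → Finset (Fin m)} (hμ : 0 ≤ μ)
    (hL : 0 ≤ L) (h : FewCollisions p μ L S) {Q P : Finset (Fin n)} (hQP : Q ⊆ P ∨ P ⊆ Q) :
    ∑ i, (if rowCount S Q i ≠ 0 then ((rowCount S P i - 1 : ℕ) : ℝ) else 0) ≤
      6 * #P * #Q * μ + 30 * #P * L := by
  have hsum : ∀ T, ∑ i, ((rowCount S T i - 1 : ℕ) : ℝ) ≤ 20 * #T * L + 4 * #T ^ 2 * μ :=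
    fun T => by simpa [excessPow] using h.one_le T
  rcases hQP with hQP | hPQ
  · have hc : (#Q : ℝ) + #(P \ Q) = #P := by
      rw [add_comm]; exact_mod_cast card_sdiff_add_card_eq_card hQP
    have h1 := h.hits_le Q (P \ Q) disjoint_sdiff
    have h2 : ∑ i, (if rowCount S Q i ≠ 0 then ((rowCount S P i - 1 : ℕ) : ℝ) else 0) ≤
        ∑ i, ((rowCount S Q i - 1 : ℕ) : ℝ) + hits S Q (P \ Q) := by
      rw [hits_eq_sum]
      push_cast
      rw [← sum_add_distrib]
      refine sum_le_sum fun i _ => ?_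
      rw [rowCount_sdiff S hQP]
      split_ifs with h0
      · rw [← Nat.cast_add]
        exact_mod_cast (by omega)
      · positivity
    have h3 := hsum Q
    rw [hc] at h1
    have hq0 : (0 : ℝ) ≤ #Q := by positivity
    have hd0 : (0 : ℝ) ≤ #(P \ Q) := by positivity
    have e1 : 0 ≤ (#(P \ Q) : ℝ) * L := mul_nonneg hd0 hL
    have e2 : 0 ≤ (#(P \ Q) : ℝ) * #Q * μ := by positivity
    have e3 : 0 ≤ (#Q : ℝ) ^ 2 * μ := by positivity
    rw [← hc] at h1 ⊢
    nlinarith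
  · have hc : (#P : ℝ) ≤ #Q := by exact_mod_cast card_le_card hPQ
    calc _ ≤ ∑ i, ((rowCount S P i - 1 : ℕ) : ℝ) := by
          refine sum_le_sum fun i _ => ?_
          split_ifs
          · exact le_rfl
          · positivity
      _ ≤ _ := hsum P
      _ ≤ _ := by
          have e1 : (0 : ℝ) ≤ #P * L := by positivity
          have e2 : (0 : ℝ) ≤ #P * μ := by positivity
          have e3 : (0 : ℝ) ≤ #P * #Q * μ := by positivity
          nlinarith [mul_le_mul_of_nonneg_left hc e2]

theorem sum_top_mul_rest_le {m n : ℕ} {p μ L : ℝ} {S : Fin n → Finset (Fin m)} (hμ : 0 ≤ μ)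
    (hL : 0 ≤ L) (h : FewCollisions p μ L S) {a u : Fin n → ℝ} {c c' : Finset (Fin n) → ℝ}
    (hc : IsLayering a a c) (hc' : IsLayering a u c') :
    ∑ i, (∑ Q, if rowCount S Q i ≠ 0 then c' Q else 0) *
        (∑ P, c P * (rowCount S P i - 1 : ℕ)) ≤
      6 * μ * ((∑ j, a j) * ∑ j, u j) + 30 * L * ((∑ j, a j) * ∑ Q, c' Q) := by
  calc _ = ∑ Q, ∑ P, c' Q * c P *
        ∑ i, (if rowCount S Q i ≠ 0 then ((rowCount S P i - 1 : ℕ) : ℝ) else 0) := by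
        rw [sum_congr rfl fun i _ => sum_mul_sum _ _ _ _, sum_comm]
        refine sum_congr rfl fun Q _ => ?_
        rw [sum_comm]
        refine sum_congr rfl fun P _ => ?_
        rw [mul_sum]
        refine sum_congr rfl fun i _ => ?_
        split_ifs <;> ring
    _ ≤ ∑ Q, ∑ P, c' Q * c P * (6 * #P * #Q * μ + 30 * #P * L) := by
        refine sum_le_sum fun Q _ => sum_le_sum fun P _ => ?_
        by_cases hQ : c' Q = 0
        · simp [hQ]
        by_cases hP : c P = 0
        · simp [hP]
        exact mul_le_mul_of_nonneg_left
          (excess_on_rows_le hμ hL h (hc.subset_or_subset hc' hP hQ))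
          (mul_nonneg (hc'.nonneg Q) (hc.nonneg P))
    _ = _ := by
        rw [← hc.sum_mul_card, ← hc'.sum_mul_card, mul_comm (∑ P, c P * #P),
          mul_comm (∑ P, c P * #P), sum_mul_sum, sum_mul_sum, mul_sum, mul_sum,
          ← sum_add_distrib]
        refine sum_congr rfl fun Q _ => ?_
        rw [mul_sum, mul_sum, ← sum_add_distrib]
        refine sum_congr rfl fun P _ => ?_
        ring

theorem sum_rest_rpow_le {m n k : ℕ} {p μ L : ℝ} (hp : 1 < p) (hp2 : p ≤ 2)
    {S : Fin n → Finset (Fin m)} (hμ : 0 ≤ μ)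
    (h : FewCollisions p μ L S) {a : Fin n → ℝ} {c : Finset (Fin n) → ℝ}
    (hc : IsLayering a a c) (hk : #{j | a j ≠ 0} ≤ k) :
    ∑ i, (∑ P, c P * (rowCount S P i - 1 : ℕ)) ^ p ≤
      (20 * L + 4 * μ * (k : ℝ) ^ (2 - p)) * (∑ j, a j) ^ p := by
  set A := ∑ j, a j with hA
  set γ := 20 * L + 4 * μ * (k : ℝ) ^ (2 - p)
  have hA' : ∑ P, c P * #P = A := hc.sum_mul_card
  have hcP0 : ∀ P, 0 ≤ c P * #P := fun P => mul_nonneg (hc.nonneg P) (by positivity)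
  have hA0 : 0 ≤ A := hA' ▸ sum_nonneg fun P _ => hcP0 P
  rcases hA0.eq_or_lt with hA1 | hA1
  · have hz : ∀ P, c P = 0 := fun P => by
      by_contra hP
      have := (sum_eq_zero_iff_of_nonneg fun P _ => hcP0 P).1 (hA'.trans hA1.symm) P (mem_univ _)
      have h2 := (hc.nonempty P hP).card_pos
      rcases mul_eq_zero.1 this with h3 | h3
      · exact hP h3
      · exact h2.ne' (by exact_mod_cast h3)
    rw [← hA1]
    simp [hz, Real.zero_rpow (show p ≠ 0 by linarith)]
  · have hw1 : ∑ P, c P * #P / A = 1 := by rw [← sum_div, hA', div_self hA1.ne']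
    have hγ : ∀ P, c P ≠ 0 → excessPow p S P ≤ γ * (#P : ℝ) ^ p := fun P hP => by
      have hs : (0 : ℝ) < #P := by exact_mod_cast (hc.nonempty P hP).card_pos
      have hsk : (#P : ℝ) ≤ k := by
        refine mod_cast (card_le_card fun j hj => ?_).trans hk
        simpa using (hc.pos_of_mem hP hj).ne'
      have e : (#P : ℝ) ^ 2 = #P ^ (2 - p) * #P ^ p := by
        rw [← Real.rpow_add hs]; norm_num
      have h1 := h.pow_le P
      have h2 := Real.rpow_le_rpow hs.le hsk (show 0 ≤ 2 - p by linarith)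
      calc _ ≤ _ := h1
        _ = (20 * L + 4 * μ * (#P : ℝ) ^ (2 - p)) * (#P : ℝ) ^ p := by rw [e]; ring
        _ ≤ γ * (#P : ℝ) ^ p := by simp only [γ]; gcongr
    calc ∑ i, (∑ P, c P * (rowCount S P i - 1 : ℕ)) ^ p
        ≤ ∑ i, ∑ P, c P * #P / A * (A * (rowCount S P i - 1 : ℕ) / #P) ^ p := by
          refine sum_le_sum fun i _ => ?_
          -- Jensen with the weights `c P * #P / A`, which sum to `1`; it reduces the claim to
          -- single layers, each of size at most `k`.
          refine le_trans (le_of_eq ?_) (Real.rpow_arith_mean_le_arith_mean_rpow univ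
            (fun P => c P * #P / A) (fun P => A * (rowCount S P i - 1 : ℕ) / #P)
            (fun P _ => div_nonneg (hcP0 P) hA0) hw1 (fun P _ => by positivity) hp.le)
          congr 1
          refine sum_congr rfl fun P _ => ?_
          by_cases hP : c P = 0
          · simp [hP]
          have hs : (#P : ℝ) ≠ 0 := by exact_mod_cast (hc.nonempty P hP).card_pos.ne'
          field_simp
      _ = ∑ P, c P * #P / A * (A ^ p / #P ^ p * excessPow p S P) := by
          rw [sum_comm]
          refine sum_congr rfl fun P _ => ?_
          rw [excessPow, mul_sum, mul_sum]
          refine sum_congr rfl fun i _ => ?_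
          rw [Real.div_rpow (by positivity) (by positivity),
            Real.mul_rpow hA0 (by positivity)]
          ring
      _ ≤ ∑ P, c P * #P / A * (γ * A ^ p) := by
          refine sum_le_sum fun P _ => ?_
          by_cases hP : c P = 0
          · simp [hP]
          have hs : (0 : ℝ) < #P := by exact_mod_cast (hc.nonempty P hP).card_pos
          refine mul_le_mul_of_nonneg_left ?_ (div_nonneg (hcP0 P) hA0)
          calc _ ≤ A ^ p / #P ^ p * (γ * (#P : ℝ) ^ p) :=
                mul_le_mul_of_nonneg_left (hγ P hP) (by positivity)
            _ = _ := by
                have : (#P : ℝ) ^ p ≠ 0 := (Real.rpow_pos_of_pos hs p).ne'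
                field_simp
      _ = γ * A ^ p := by rw [← sum_mul, hw1, one_mul]

/-- Distortion of `p`-th powers of norms for sparse vectors. -/
theorem abs_sum_rows_sub_le {m n d k : ℕ} {p μ L : ℝ} (hp : 1 < p) (hp2 : p ≤ 2) (hμ : 0 ≤ μ)
    (hL : 0 ≤ L) {S : Fin n → Finset (Fin m)} (hS : S ∈ columnSupports m n d)
    (h : FewCollisions p μ L S) (x : Fin n → ℝ) (hk : #{j | x j ≠ 0} ≤ k) :
    |(∑ i, |∑ j with i ∈ S j, x j| ^ p - d * ∑ j, |x j| ^ p)| ≤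
      (26 * μ * k + 130 * L * (k : ℝ) ^ (p - 1)) * ∑ j, |x j| ^ p := by
  set X := ∑ j, |x j| ^ p with hX
  have hX0 : 0 ≤ X := sum_nonneg fun _ _ => by positivity
  set a : Fin n → ℝ := fun j => |x j| with ha
  set u : Fin n → ℝ := fun j => |x j| ^ (p - 1) with hu
  have hmono : ∀ j l, a j ≤ a l → u j ≤ u l := fun j l hjl =>
    Real.rpow_le_rpow (abs_nonneg _) hjl (by linarith)
  have ha0 : ∀ j, 0 ≤ a j := fun j => abs_nonneg _
  obtain ⟨c, hc⟩ := exists_isLayering a ha0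
  obtain ⟨c', hc'0⟩ := exists_isLayering u fun j => by positivity
  have hc' := hc'0.of_monotone hmono
  set y : Fin m → ℝ := fun i => ∑ P, c P * (rowCount S P i - 1 : ℕ) with hy
  set t : Fin m → ℝ := fun i => ∑ Q, if rowCount S Q i ≠ 0 then c' Q else 0 with ht
  have hka : #{j | a j ≠ 0} ≤ k := by simpa [ha] using hk
  have hrow : ∀ i, |(|∑ j with i ∈ S j, x j| ^ p - ∑ j with i ∈ S j, |x j| ^ p)| ≤
      3 * (t i * y i) + 2 * y i ^ p := fun i => by
    rcases (univ.filter fun j => i ∈ S j).eq_empty_or_nonempty with hE | hne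
    · rw [hE]
      have hr : ∀ P, rowCount S P i = 0 := fun P => by
        have := rowCount_mono S (subset_univ P) i
        rw [rowCount, rowCount, hE, card_empty] at this
        exact Nat.le_zero.1 this
      simp [y, t, hr, Real.zero_rpow (show p ≠ 0 by linarith)]
    · obtain ⟨j, hj, hmax⟩ := exists_max_image _ a hne
      have hj' : i ∈ S j := (mem_filter.1 hj).2
      have hmax' : ∀ l, i ∈ S l → a l ≤ a j := fun l hl =>
        hmax l (mem_filter.2 ⟨mem_univ _, hl⟩)
      have h1 := abs_rpow_sum_sub_le hp hp2 _ x hj hmax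
      have h2 := hc.sum_row_sub_max S hj' hmax'
      have h3 := hc'.eq_sum_of_max S hj' hmax'
      simp only [ha, hu] at h2 h3
      rw [h2, h3] at h1
      exact h1
  have hdX : d * X = ∑ i, ∑ j with i ∈ S j, |x j| ^ p := by
    simp only [sum_filter]
    rw [sum_comm, hX, mul_sum]
    refine sum_congr rfl fun j _ => ?_
    rw [← sum_filter, sum_const, nsmul_eq_mul, filter_mem_eq_inter, univ_inter,
      mem_columnSupports.1 hS]
  have hA : (∑ j, a j) ^ p ≤ (k : ℝ) ^ (p - 1) * X := by
    have h1 := Real.rpow_sum_le_const_mul_sum_rpow {j | x j ≠ 0} x hp.le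
    have e1 : ∑ j with x j ≠ 0, |x j| = ∑ j, a j := by
      rw [sum_filter]
      refine sum_congr rfl fun j _ => ?_
      split_ifs with h0
      · rfl
      · simp [ha, not_not.1 h0]
    have e2 : ∑ j with x j ≠ 0, |x j| ^ p ≤ X :=
      sum_le_sum_of_subset_of_nonneg (subset_univ _) fun _ _ _ => by positivity
    rw [e1] at h1
    refine h1.trans ?_
    gcongr
  have hA0 : 0 ≤ ∑ j, a j := sum_nonneg fun j _ => ha0 j
  have hAU : (∑ j, a j) * ∑ j, u j ≤ k * X := by
    -- Chebyshev's sum inequality on the support: `a` and `u` are ordered alike and `a * u = |x| ^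
    -- p`.
    have hmv : MonovaryOn a u ({j | x j ≠ 0} : Finset (Fin n)) := fun j _ l _ hjl => by
      by_contra hcon
      exact absurd (hmono l j (not_le.1 hcon).le) (not_le.2 hjl)
    have h1 := hmv.sum_mul_sum_le_card_mul_sum
    have e : ∀ f : Fin n → ℝ, (∀ j, x j = 0 → f j = 0) → ∑ j with x j ≠ 0, f j = ∑ j, f j := by
      intro f hf
      rw [sum_filter]
      refine sum_congr rfl fun j _ => ?_
      split_ifs with h0
      · rfl
      · exact (hf j (not_not.1 h0)).symm
    rw [e a (fun j hj => by simp [ha, hj]),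
      e u (fun j hj => by simp [hu, hj, Real.zero_rpow (show p - 1 ≠ 0 by linarith)]),
      e (fun j => a j * u j) (fun j hj => by simp [ha, hj])] at h1
    have e3 : ∑ j, a j * u j = X := sum_congr rfl fun j _ => by
      rw [mul_comm]; exact rpow_sub_one_mul_self hp (abs_nonneg _)
    rw [e3] at h1
    refine h1.trans ?_
    gcongr
  have hAc : (∑ j, a j) * ∑ Q, c' Q ≤ (k : ℝ) ^ (p - 1) * X := by
    refine le_trans ?_ hA
    rw [← rpow_sub_one_mul_self hp hA0, mul_comm]
    refine mul_le_mul_of_nonneg_right (hc'.sum_le (by positivity) fun j => ?_) hA0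
    exact Real.rpow_le_rpow (ha0 j) (single_le_sum (fun j _ => ha0 j) (mem_univ j)) (by linarith)
  have hB := sum_top_mul_rest_le hμ hL h hc hc'
  have hC := sum_rest_rpow_le hp hp2 hμ h hc hka
  have hkk : (k : ℝ) ^ (2 - p) * ((k : ℝ) ^ (p - 1) * X) = k * X := by
    rw [← mul_assoc]
    rcases Nat.eq_zero_or_pos k with rfl | hk0
    · simp [Real.zero_rpow (show p - 1 ≠ 0 by linarith)]
    · rw [← Real.rpow_add (by positivity)]; norm_num
  rw [hdX, ← sum_sub_distrib]
  calc _ ≤ ∑ i, (3 * (t i * y i) + 2 * y i ^ p) :=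
        (abs_sum_le_sum_abs _ _).trans (sum_le_sum fun i _ => hrow i)
    _ = 3 * ∑ i, t i * y i + 2 * ∑ i, y i ^ p := by
        rw [sum_add_distrib, ← mul_sum, ← mul_sum]
    _ ≤ 3 * (6 * μ * (k * X) + 30 * L * ((k : ℝ) ^ (p - 1) * X)) +
        2 * ((20 * L + 4 * μ * (k : ℝ) ^ (2 - p)) * ((k : ℝ) ^ (p - 1) * X)) := by
        refine add_le_add (mul_le_mul_of_nonneg_left (hB.trans ?_) (by norm_num))
          (mul_le_mul_of_nonneg_left (hC.trans ?_) (by norm_num))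
        · gcongr
        · gcongr
    -- The constants are `26 = 3 * 6 + 2 * 4` and `130 = 3 * 30 + 2 * 20`.
    _ = _ := by linear_combination 8 * μ * hkk

/-! ### From collision bounds to the random matrix -/

theorem lpNorm_rpow {N : ℕ} {p : ℝ} (hp : 0 < p) (x : Fin N → ℝ) :
    lpNorm p x ^ p = ∑ j, |x j| ^ p := by
  have hp' : (ENNReal.ofReal p).toReal = p := ENNReal.toReal_ofReal hp.le
  rw [lpNorm, PiLp.norm_eq_sum (by rwa [hp']), hp', ← Real.rpow_mul
    (sum_nonneg fun _ _ => by positivity), one_div, inv_mul_cancel₀ hp.ne', Real.rpow_one]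
  rfl

theorem lpNorm_binaryMatrix_mulVec_rpow {m n d : ℕ} {p : ℝ} (hp : 0 < p)
    (S : Fin n → Finset (Fin m)) (x : Fin n → ℝ) :
    lpNorm p ((binaryMatrix p d S).mulVec x) ^ p =
      (d : ℝ)⁻¹ * ∑ i, |∑ j with i ∈ S j, x j| ^ p := by
  rw [lpNorm_rpow hp, mul_sum]
  refine sum_congr rfl fun i _ => ?_
  have e : (binaryMatrix p d S).mulVec x i =
      (d : ℝ) ^ (-(1 / p)) * ∑ j with i ∈ S j, x j := by
    rw [Matrix.mulVec, dotProduct, sum_filter, mul_sum]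
    refine sum_congr rfl fun j _ => ?_
    simp [binaryMatrix]
  rw [e, abs_mul, Real.mul_rpow (abs_nonneg _) (abs_nonneg _), abs_of_nonneg (by positivity),
    ← Real.rpow_mul (by positivity), ← Real.rpow_neg_one]
  congr 2
  field_simp

theorem FewCollisions.isRIPPow {m n d k : ℕ} {p μ L ε : ℝ} (hp : 1 < p) (hp2 : p ≤ 2)
    (hμ : 0 ≤ μ) (hL : 0 ≤ L) (hd : 0 < d) {S : Fin n → Finset (Fin m)}
    (hS : S ∈ columnSupports m n d) (h : FewCollisions p μ L S)
    (hε : 26 * μ * k + 130 * L * (k : ℝ) ^ (p - 1) ≤ ε * d) :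
    IsRIPPow k ε p (binaryMatrix p d S) := by
  intro x hx
  have hd0 : (0 : ℝ) < d := by exact_mod_cast hd
  have hk : #{j | x j ≠ 0} ≤ k := by
    rw [IsSparse, Set.ncard_eq_toFinset_card'] at hx
    simpa using hx
  have h1 := abs_sum_rows_sub_le hp hp2 hμ hL hS h x hk
  have hX0 : 0 ≤ ∑ j, |x j| ^ p := sum_nonneg fun _ _ => by positivity
  have h2 := abs_le.1 (h1.trans (mul_le_mul_of_nonneg_right hε hX0))
  rw [lpNorm_binaryMatrix_mulVec_rpow (by linarith), lpNorm_rpow (by linarith),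
    inv_mul_eq_div, le_div_iff₀ hd0, div_le_iff₀ hd0]
  constructor <;> nlinarith [h2.1, h2.2]

theorem randomBinaryMatrix_isRIPPow {m n d k : ℕ} {p ε : ℝ} (hp : 1 < p) (hp2 : p ≤ 2)
    (hn : 2 ≤ n) (hd : 0 < d) (hdm : d ≤ m)
    (hε : 26 * (d ^ 2 / m) * k + 130 * Real.log n * (k : ℝ) ^ (p - 1) ≤ ε * d) :
    (98 / 100 : ENNReal) ≤
      (randomBinaryMatrix p n hdm).toOuterMeasure {A | IsRIPPow k ε p A} := by
  classical
  have hb := card_not_fewCollisions_le (n := n) hp.le hp2 (hd.trans_le hdm) hdm hn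
  rw [randomBinaryMatrix, PMF.toOuterMeasure_map_apply, PMF.toOuterMeasure_uniformOfFinset_apply]
  set Ω := columnSupports m n d
  have hsplit := card_filter_add_card_filter_not (s := Ω)
    (fun S => FewCollisions p (d ^ 2 / m) (Real.log n) S)
  have hle : #{S ∈ Ω | FewCollisions p (d ^ 2 / m) (Real.log n) S} ≤
      #{S ∈ Ω | S ∈ binaryMatrix p d ⁻¹' {A | IsRIPPow k ε p A}} := by
    refine card_le_card fun S hS => ?_
    rw [mem_filter] at hS ⊢
    exact ⟨hS.1, hS.2.isRIPPow hp hp2 (by positivity) (Real.log_natCast_nonneg n) hd hS.1 hε⟩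
  have hnat : 98 * #Ω ≤ #{S ∈ Ω | S ∈ binaryMatrix p d ⁻¹' {A | IsRIPPow k ε p A}} * 100 := by
    have h1 : (50 * #{S ∈ Ω | ¬ FewCollisions p (d ^ 2 / m) (Real.log n) S} : ℝ) ≤ #Ω := by
      have : (0 : ℝ) ≤ #Ω := by positivity
      linarith
    have h2 : 50 * #{S ∈ Ω | ¬ FewCollisions p (d ^ 2 / m) (Real.log n) S} ≤ #Ω := by
      exact_mod_cast h1
    omega
  rw [ENNReal.le_div_iff_mul_le
    (Or.inl (by simpa using (columnSupports_nonempty n hdm).ne_empty)) (Or.inl (by simp)),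
    ← ENNReal.mul_div_right_comm, ENNReal.div_le_iff (by norm_num) (by norm_num)]
  exact_mod_cast hnat

/-! ### Choice of dimensions -/

theorem exists_dimensions {n k : ℕ} {p ε : ℝ} (hn : 2 ≤ n) (hk : 1 ≤ k) (hp : 1 ≤ p)
    (hε : 0 < ε) (hε2 : ε < 1 / 2) :
    ∃ m d : ℕ, d ≤ m ∧ 0 < d ∧
      (m : ℝ) ≤ 13833 * ((k : ℝ) ^ p * Real.log n / ε ^ 2) ∧
      (d : ℝ) ≤ 13833 * ((k : ℝ) ^ (p - 1) * Real.log n / ε) ∧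
      26 * ((d : ℝ) ^ 2 / m) * k + 130 * Real.log n * (k : ℝ) ^ (p - 1) ≤ ε * d := by
  have hk1 : (1 : ℝ) ≤ k := by exact_mod_cast hk
  have hL : 1 / 2 ≤ Real.log n := by
    have := Real.log_le_log two_pos (show (2 : ℝ) ≤ n by exact_mod_cast hn)
    linarith [Real.log_two_gt_d9]
  set L := Real.log n
  have hkp : 1 ≤ (k : ℝ) ^ (p - 1) := Real.one_le_rpow hk1 (by linarith)
  set W : ℝ := (k : ℝ) ^ (p - 1) * L / ε with hW
  have hW1 : 1 ≤ W := by
    rw [hW, le_div_iff₀ hε]; nlinarith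
  -- This `d` makes the logarithmic term at most `ε * d / 2`, and the next `m` does so for the
  -- collision term. As `W ≥ 1`, rounding up raises `260` and `52` at most to `261` and `53`.
  obtain ⟨d, hd⟩ : ∃ d : ℕ, d = ⌈260 * W⌉₊ := ⟨_, rfl⟩
  obtain ⟨m, hm⟩ : ∃ m : ℕ, m = ⌈52 * k * d / ε⌉₊ := ⟨_, rfl⟩
  have hd1 : 260 * W ≤ d := hd ▸ Nat.le_ceil _
  have hd2 : (d : ℝ) ≤ 261 * W := by
    have := Nat.ceil_lt_add_one (show 0 ≤ 260 * W by linarith)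
    rw [← hd] at this
    linarith
  have hd0 : (0 : ℝ) < d := by linarith
  have hm1 : 52 * k * d / ε ≤ m := hm ▸ Nat.le_ceil _
  have hkd : (d : ℝ) ≤ k * d / ε := by
    rw [le_div_iff₀ hε]; nlinarith
  have hm2 : (m : ℝ) ≤ 53 * (k * d / ε) := by
    have := Nat.ceil_lt_add_one (show 0 ≤ 52 * k * d / ε by positivity)
    rw [← hm, mul_assoc, mul_div_assoc] at this
    linarith
  have hdm : (d : ℝ) ≤ m := by
    rw [mul_assoc, mul_div_assoc] at hm1
    linarith
  have hm0 : (0 : ℝ) < m := hd0.trans_le hdm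
  refine ⟨m, d, by exact_mod_cast hdm, by exact_mod_cast hd0, ?_, by linarith, ?_⟩
  · have e : (k : ℝ) ^ p * L / ε ^ 2 = k * W / ε := by
      have : (k : ℝ) ^ p = (k : ℝ) ^ (p - 1) * k := by
        rw [← Real.rpow_add_one (by linarith)]; ring_nf
      rw [this, hW]
      field_simp
    rw [e]
    calc (m : ℝ) ≤ 53 * (k * d / ε) := hm2
      _ ≤ 53 * (k * (261 * W) / ε) := by gcongr
      _ = _ := by ring
  · have h1 : 130 * L * (k : ℝ) ^ (p - 1) ≤ ε * d / 2 := by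
      have : (k : ℝ) ^ (p - 1) * L = ε * W := by rw [hW]; field_simp
      nlinarith
    have h2 : 26 * ((d : ℝ) ^ 2 / m) * k ≤ ε * d / 2 := by
      rw [div_le_iff₀ hε] at hm1
      have : 26 * ((d : ℝ) ^ 2 / m) * k = 26 * d ^ 2 * k / m := by ring
      rw [this, div_le_iff₀ hm0]
      nlinarith
    linarith

end RIP

theorem mainTheorem2 (τ : ℝ) (hτ : 0 < τ) :
    ∃ C : ℝ, 0 < C ∧
      ∀ (n k : ℕ) (ε p : ℝ), 2 ≤ n → 1 ≤ k → k ≤ n → 0 < ε → ε < 1 / 2 →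
        1 + τ ≤ p → p ≤ 2 - τ →
        ∃ (m d : ℕ) (hdm : d ≤ m), 0 < m ∧ 0 < d ∧
          (m : ℝ) ≤ C * ((k : ℝ) ^ p * (Real.log n / ε ^ 2) +
            (k : ℝ) ^ (4 - 2 / p - p) * (Real.log n / ε ^ (2 / (p - 1)))) ∧
          (d : ℝ) ≤ C * ((k : ℝ) ^ (p - 1) * Real.log n / ε +
            (k : ℝ) ^ ((p - 1) / p) * Real.log n / ε ^ (1 / (p - 1))) ∧
          (ε ^ (-(p * (2 - p) / (p - 1) ^ 3)) ≤ (k : ℝ) →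
            (m : ℝ) ≤ C * ((k : ℝ) ^ p * Real.log n / ε ^ 2) ∧
            (d : ℝ) ≤ C * ((k : ℝ) ^ (p - 1) * Real.log n / ε)) ∧
          (98 / 100 : ENNReal) ≤
            (RIP.randomBinaryMatrix p n hdm).toOuterMeasure {A | RIP.IsRIPPow k ε p A} := by
  -- The constant is `13833 = 53 * 261`. The first summands alone already bound `m` and `d`; the
  -- second ones are non-negative.
  refine ⟨13833, by norm_num, fun n k ε p hn hk _ hε hε2 hp1 hp2 => ?_⟩
  obtain ⟨m, d, hdm, hd, hm, hdb, h⟩ :=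
    RIP.exists_dimensions (p := p) hn hk (by linarith) hε hε2
  have hL : 0 ≤ Real.log n := Real.log_natCast_nonneg n
  refine ⟨m, d, hdm, hd.trans_le hdm, hd, hm.trans ?_, hdb.trans ?_, fun _ => ⟨hm, hdb⟩,
    RIP.randomBinaryMatrix_isRIPPow (by linarith) (by linarith) hn hd hdm h⟩
  · rw [mul_div_assoc]
    have : 0 ≤ (k : ℝ) ^ (4 - 2 / p - p) * (Real.log n / ε ^ (2 / (p - 1))) := by positivity
    linarith
  · have : 0 ≤ (k : ℝ) ^ ((p - 1) / p) * Real.log n / ε ^ (1 / (p - 1)) := by positivity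
    linarith
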